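/- Let $S$ be a countably infinite set, let $\binom S2$ be the set of its two-element subsets (edges), and let $X=\{0,1\}^{\binom S2}$ be the space of graphs on $S$ with its product $\sigma$-algebra and coordinate projections $\pi_e:X\to\{0,1\}$, $e\in\binom S2$. Let $\mathrm{Sym}_0(S)$ be the group of finitely supported permutations of $S$, acting on $X$ by $\tau^g\big((\omega_e)_{e}\big)=(\omega_{g(e)})_{e}$. Let $\mu$ be the law on $X$ of the random complete bipartite graph: choose types $z_s\in\{\text{red},\text{blue}\}$, $s\in S$, independently and with probability $\tfrac12$ each, and put $\omega_{\{s,t\}}=1$ if $z_s\neq z_t$ and $\omega_{\{s,t\}}=0$ otherwise. Then: 1. $\mu$ is exchangeable: $(\tau^g)_\#\mu=\mu$ for every $g\in\mathrm{Sym}_0(S)$. 2. For $s\in S$ let $\Xi_s$ be the $\sigma$-algebra of all measurable $A\subseteq X$ with $(\tau^g)^{-1}(A)=A$ for every $g\in\mathrm{Sym}_0(S)$ with $g(s)=s$. Then $\Xi_s$ is $\mu$-trivial: $\mu(A)\in\{0,1\}$ for every $A\in\Xi_s$. 3. For no standard Borel space $Z$ is there a family $(\phi_s)_{s\in S}$ of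 measurable maps $\phi_s:X\to Z$ with both of the following properties: - (covariance) $\phi_s\circ\tau^g=\phi_{g(s)}$ $\mu$-almost everywhere, for every $g\in\mathrm{Sym}_0(S)$ and $s\in S$; - (relative independence) the random variables $(\pi_e)_{e\in\binom S2}$ are conditionally independent under $\mu$ given the $\sigma$-algebra generated by the combined map $(\phi_s)_{s\in S}:X\to Z^S$. In particular there is no such family for which the covariance identity holds everywhere, so the vertex-type spaces of a structure theorem for exchangeable random graphs cannot in general be obtained as factors of the original space $(X,\mu)$. -/

import Mathlib

open MeasureTheory ProbabilityTheory

namespace ExchGraph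

/-- The edges of the complete graph on `S`: the two-element subsets of `S`. -/
abbrev Edge (S : Type*) : Type _ := ↥(Set.powersetCard S 2)

/-- `{0,1}`-coloured graphs on `S`, with the product σ-algebra; `1` stands for an edge. -/
abbrev Graph (S : Type*) : Type _ := Edge S → Fin 2

/-- The coordinate projection `π_e`. -/
def proj {S : Type*} (e : Edge S) (ω : Graph S) : Fin 2 := ω e

/-- `Sym₀(S)`: the group of finitely supported permutations of `S`. -/
def finSym (S : Type*) : Subgroup (Equiv.Perm S) where
  carrier := {g | {x | g x ≠ x}.Finite}
  one_mem' := by simp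
  mul_mem' := by
    intro a b ha hb
    refine (Set.Finite.union ha hb).subset ?_
    intro x hx
    by_cases h : b x = x
    · left
      simpa [h] using hx
    · exact Or.inr h
  inv_mem' := by
    intro a ha
    refine Set.Finite.subset ha ?_
    intro x hx h
    exact hx (by rw [Equiv.Perm.inv_eq_iff_eq]; exact h.symm)

/-- The image `g(e)` of the edge `e` under a permutation `g`. -/
def moveEdge {S : Type*} (g : Equiv.Perm S) (e : Edge S) : Edge S :=
  Set.powersetCard.map 2 g.toEmbedding e

/-- The coordinate-permuting action `τ^g ((ω_e)_e) = (ω_{g(e)})_e`. -/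
def relabel {S : Type*} (g : Equiv.Perm S) (ω : Graph S) : Graph S :=
  fun e => ω (moveEdge g e)

/-- Exchangeability: invariance of the law under the action of `Sym₀(S)`. -/
def Exchangeable {S : Type*} (μ : Measure (Graph S)) : Prop :=
  ∀ g ∈ finSym S, μ.map (relabel g) = μ

/-- The fair law on the two vertex types (the two elements of `Bool`: red and blue). -/
noncomputable def fairType : Measure Bool := (PMF.uniformOfFintype Bool).toMeasure

instance : IsProbabilityMeasure fairType := by
  unfold fairType
  infer_instance

open Classical in
/-- The complete bipartite graph of a family of vertex types: an edge is present if and only if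
its two ends have different types. -/
noncomputable def typeGraph {S : Type*} (z : S → Bool) : Graph S :=
  fun e => if ∃ s ∈ e.1, ∃ t ∈ e.1, z s ≠ z t then 1 else 0

lemma measurable_typeGraph {S : Type*} : Measurable (typeGraph (S := S)) := by
  classical
  refine measurable_pi_lambda _ fun e => ?_
  unfold typeGraph
  refine Measurable.ite ?_ measurable_const measurable_const
  have : {z : S → Bool | ∃ s ∈ e.1, ∃ t ∈ e.1, z s ≠ z t}
      = ⋃ s ∈ e.1, ⋃ t ∈ e.1, {z : S → Bool | z s = z t}ᶜ := by
    ext z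
    simp
  rw [this]
  exact Finset.measurableSet_biUnion _ fun s _ => Finset.measurableSet_biUnion _ fun t _ =>
    (measurableSet_eq_fun (measurable_pi_apply s) (measurable_pi_apply t)).compl

/-- The law of the random complete bipartite graph on `S`: vertex types are independent and
fair. -/
noncomputable def bipartiteLaw (S : Type*) : Measure (Graph S) :=
  (Measure.infinitePi fun _ : S => fairType).map typeGraph

instance {S : Type*} : IsProbabilityMeasure (bipartiteLaw S) :=
  Measure.isProbabilityMeasure_map measurable_typeGraph.aemeasurable

/-- The σ-algebra `Ξ_s` of all measurable sets of graphs that are invariant under `τ^g` for every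
`g ∈ Sym₀(S)` with `g(s) = s`. -/
@[reducible]
def stabInvariants {S : Type*} (s : S) : MeasurableSpace (Graph S) :=
  ⨅ g : {g : Equiv.Perm S // g ∈ finSym S ∧ g s = s}, MeasurableSpace.invariants (relabel g.1)

/-- Covariance of a family of maps: `φ_s ∘ τ^g = φ_{g(s)}` for every `g ∈ Sym₀(S)`, up to
`μ`-null sets. -/
def Covariant {S Z : Type*} (μ : Measure (Graph S)) (φ : S → Graph S → Z) : Prop :=
  ∀ g ∈ finSym S, ∀ s : S, φ s ∘ relabel g =ᵐ[μ] φ (g s)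

/-- The combined map `(φ_s)_{s ∈ S}`. -/
def combined {S Z : Type*} (φ : S → Graph S → Z) (ω : Graph S) : S → Z := fun s => φ s ω

lemma measurable_combined {S Z : Type*} [MeasurableSpace Z] {φ : S → Graph S → Z}
    (hφ : ∀ s, Measurable (φ s)) : Measurable (combined φ) :=
  measurable_pi_lambda _ hφ

/-- The edge variables `π_e` are relatively independent over the combined map `(φ_s)_{s ∈ S}`:
they are conditionally independent given the σ-algebra that it generates. -/
def EdgesRelIndep {S Z : Type*} [Countable S] [MeasurableSpace Z] (μ : Measure (Graph S))
    [IsFiniteMeasure μ] (φ : S → Graph S → Z) (hφ : ∀ s, Measurable (φ s)) : Prop :=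
  iCondIndepFun (MeasurableSpace.comap (combined φ) inferInstance)
    (measurable_combined hφ).comap_le (fun e : Edge S => proj e) μ

end ExchGraph

namespace ExchGraph

/-! ### Hewitt–Savage zero-one law. -/

section ZeroOne

/-! Relabelling the graph permutes the i.i.d. vertex types, which gives exchangeability. For
triviality, the graph depends only on which types agree, so it is determined by the types relative
to that of a fixed vertex `s`. By `map_relType` these are again i.i.d. and fair, and the stabilizer
of `s` acts on them by permuting their indices. Hewitt–Savage over the remaining vertices therefore
makes every event invariant under the stabilizer trivial.

The zero-one law is proved for almost everywhere invariance because covariance only holds up to null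
sets. Covariance makes each `φ s` almost invariant under the stabilizer of `s`, so all `φ s`, and
hence the combined map, generate only trivial events (`combined_trivial`). Relative independence
would then be plain independence of the edges, which fails: each edge has positive probability,
while a triangle has probability zero. -/

lemma measurePreserving_comp_perm {T X : Type*} [MeasurableSpace X] (ρ : Measure X)
    [IsProbabilityMeasure ρ] (g : Equiv.Perm T) :
    MeasurePreserving (fun (x : T → X) t => x (g t)) (Measure.infinitePi fun _ : T => ρ)
      (Measure.infinitePi fun _ : T => ρ) where
  measurable := by fun_prop
  map_eq := Measure.map_infinitePi_infinitePi_of_inj (P := fun _ : T => ρ) g.injective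

/-- A finite set can be moved off itself by a finitely supported permutation. -/
lemma exists_finSym_disjoint {T : Type*} [Infinite T] (I : Finset T) :
    ∃ g ∈ finSym T, ∀ i ∈ I, g i ∉ I := by
  classical
  obtain ⟨J, hJI, hJ⟩ := Infinite.exists_superset_card_eq I (I.card + I.card) (by omega)
  have hcard : (J \ I).card = I.card := by
    have := Finset.card_sdiff_add_card_eq_card hJI
    omega
  let e : I ≃ ↥(J \ I) := Finset.equivOfCardEq hcard.symm
  let f : I ⊕ I ↪ T :=
    { toFun := Sum.elim (fun i => i) (fun i => e i)
      inj' := by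
        have h (i j : I) : (i : T) ≠ e j := fun h =>
          (Finset.mem_sdiff.1 (e j).2).2 (h ▸ i.2)
        rintro (i | i) (j | j) hij
        · simpa using Subtype.ext hij
        · exact (h i j hij).elim
        · exact (h j i hij.symm).elim
        · simpa using e.injective (Subtype.ext hij) }
  -- Swap `I` with its disjoint copy `J \ I` and fix everything else.
  refine ⟨Equiv.Perm.viaFintypeEmbedding (Equiv.sumComm I I) f, ?_, fun i hi => ?_⟩
  · refine (Set.finite_range f).subset fun x hx => ?_
    by_contra hx'
    exact hx (Equiv.Perm.viaFintypeEmbedding_apply_notMem_range _ _ hx')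
  · have := Equiv.Perm.viaFintypeEmbedding_apply_image (Equiv.sumComm I I) f (Sum.inl ⟨i, hi⟩)
    rw [show f (Sum.inl ⟨i, hi⟩) = i from rfl] at this
    rw [this]
    exact (Finset.mem_sdiff.1 (e ⟨i, hi⟩).2).2

lemma isSetAlgebra_measurableCylinders {T : Type*} (X : T → Type*) [∀ t, MeasurableSpace (X t)] :
    IsSetAlgebra (measurableCylinders X) where
  empty_mem := empty_mem_measurableCylinders X
  compl_mem _ hs := compl_mem_measurableCylinders hs
  union_mem _ _ hs ht := union_mem_measurableCylinders hs ht

/-- The Hewitt–Savage zero-one law, for almost everywhere symmetric events. -/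
theorem measure_eq_zero_or_one_of_ae_symmetric {T X : Type*} [Infinite T] [MeasurableSpace X]
    (ρ : Measure X) [IsProbabilityMeasure ρ] {A : Set (T → X)} (hA : MeasurableSet A)
    (hinv : ∀ g ∈ finSym T, (fun (x : T → X) t => x (g t)) ⁻¹' A
      =ᵐ[Measure.infinitePi fun _ : T => ρ] A) :
    (Measure.infinitePi fun _ : T => ρ) A = 0 ∨ (Measure.infinitePi fun _ : T => ρ) A = 1 := by
  classical
  set ν := Measure.infinitePi fun _ : T => ρ with hν
  -- Approximate `A` by a cylinder `C` within `ε` and move `C` to disjoint coordinates. With a =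
  -- ν(A) and c = ν(C), both |a - c²| and |c² - a²| are at most 2ε.
  have key : ∀ ε : ℝ, 0 < ε → |ν.real A - ν.real A * ν.real A| ≤ 4 * ε := by
    intro ε hε
    obtain ⟨C, hC, hAC⟩ := (Measure.MeasureDense.of_generateFrom_isSetAlgebra_finite ν
      (isSetAlgebra_measurableCylinders fun _ : T => X)
      generateFrom_measurableCylinders.symm).approx A hA (measure_ne_top _ _) ε hε
    obtain ⟨I, B, hB, rfl⟩ := (mem_measurableCylinders C).1 hC
    obtain ⟨g, hg, hgI⟩ := exists_finSym_disjoint I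
    set G : (T → X) → (T → X) := fun x t => x (g t) with hG
    have hGp : MeasurePreserving G ν ν := measurePreserving_comp_perm ρ g
    set C : Set (T → X) := cylinder (α := fun _ => X) I B with hCdef
    have hCm : MeasurableSet C := hB.cylinder I
    have hind : ν.real (C ∩ G ⁻¹' C) = ν.real C * ν.real C := by
      have hi : iIndepFun (fun (t : T) (x : T → X) => x t) ν :=
        iIndepFun_infinitePi (P := fun _ : T => ρ) (X := fun _ x => x) fun _ => measurable_id
      have hd : Disjoint I (I.map g.toEmbedding) := by
        rw [Finset.disjoint_right]
        intro t ht
        obtain ⟨i, hi, rfl⟩ := Finset.mem_map.1 ht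
        exact hgI i hi
      have hi2 := hi.indepFun_finset I (I.map g.toEmbedding) hd fun t => measurable_pi_apply t
      -- Reindexing exhibits `G ⁻¹' C` as a cylinder over g(I), which is disjoint from `I`.
      let φ : (↥(I.map g.toEmbedding) → X) → (I → X) := fun y i =>
        y ⟨g i, Finset.mem_map_of_mem g.toEmbedding i.2⟩
      have hφ : Measurable φ := by fun_prop
      have := hi2.measure_inter_preimage_eq_mul B (φ ⁻¹' B) hB (hφ hB)
      have h2 : ν (G ⁻¹' C) = ν C := hGp.measure_preimage hCm.nullMeasurableSet
      have h3 : ν (C ∩ G ⁻¹' C) = ν C * ν (G ⁻¹' C) := this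
      rw [measureReal_def, h3, h2, ENNReal.toReal_mul, measureReal_def]
    have h1 : ν.real (symmDiff A C) ≤ ε :=
      ENNReal.toReal_le_of_le_ofReal hε.le hAC.le
    have h2 : |ν.real A - ν.real C| ≤ ε :=
      (abs_measureReal_sub_le_measureReal_symmDiff hA.nullMeasurableSet
        hCm.nullMeasurableSet).trans h1
    have hGA : ν.real (A ∩ G ⁻¹' A) = ν.real A := by
      refine measureReal_congr ?_
      have := (Filter.EventuallyEq.refl (ae ν) A).inter (hinv g hg)
      rwa [Set.inter_self] at this
    have h3 : |ν.real (A ∩ G ⁻¹' A) - ν.real (C ∩ G ⁻¹' C)| ≤ 2 * ε := by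
      refine (abs_measureReal_sub_le_measureReal_symmDiff
        (hA.inter (hGp.measurable hA)).nullMeasurableSet
        (hCm.inter (hGp.measurable hCm)).nullMeasurableSet).trans ?_
      have hsub : symmDiff (A ∩ G ⁻¹' A) (C ∩ G ⁻¹' C)
          ⊆ symmDiff A C ∪ G ⁻¹' symmDiff A C := by
        intro x
        simp only [Set.mem_symmDiff, Set.mem_union, Set.mem_inter_iff, Set.mem_preimage]
        tauto
      have h4 : ν.real (G ⁻¹' symmDiff A C) = ν.real (symmDiff A C) := by
        rw [measureReal_def, hGp.measure_preimage (hA.symmDiff hCm).nullMeasurableSet,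
          measureReal_def]
      have h5 := measureReal_mono (μ := ν) hsub
      have h6 := measureReal_union_le (μ := ν) (symmDiff A C) (G ⁻¹' symmDiff A C)
      linarith
    rw [hGA, hind] at h3
    have ha0 : 0 ≤ ν.real A := measureReal_nonneg
    have ha1 : ν.real A ≤ 1 := measureReal_le_one
    have hc0 : 0 ≤ ν.real C := measureReal_nonneg
    have hc1 : ν.real C ≤ 1 := measureReal_le_one
    have h7 : |ν.real C * ν.real C - ν.real A * ν.real A| ≤ 2 * ε := by
      rw [show ν.real C * ν.real C - ν.real A * ν.real A
        = (ν.real C + ν.real A) * (ν.real C - ν.real A) by ring, abs_mul,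
        abs_of_nonneg (by positivity), abs_sub_comm]
      exact mul_le_mul (by linarith) h2 (abs_nonneg _) (by norm_num)
    have := abs_sub_le (ν.real A) (ν.real C * ν.real C) (ν.real A * ν.real A)
    linarith
  have h0 : ν.real A - ν.real A * ν.real A = 0 := by
    rw [← abs_eq_zero]
    refine le_antisymm (le_of_forall_pos_le_add fun ε hε => ?_) (abs_nonneg _)
    have := key (ε / 4) (by positivity)
    linarith
  have h1 : ν.real A * (1 - ν.real A) = 0 := by linarith
  rcases mul_eq_zero.1 h1 with h | h
  · left
    exact (measureReal_eq_zero_iff (measure_ne_top _ _)).1 h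
  · right
    have h' : ν.real A = 1 := by linarith
    rw [measureReal_def] at h'
    exact (ENNReal.toReal_eq_one_iff _).1 h'

end ZeroOne

/-! ### Fixing the colour of one vertex. -/

section Normalization

variable {S : Type*}

/-- The colouring that extends `y` by `false` at the vertex `s`. -/
noncomputable def extendType (s : S) (y : {t // t ≠ s} → Bool) (t : S) : Bool :=
  open Classical in if h : t ≠ s then y ⟨t, h⟩ else false

lemma measurable_extendType (s : S) : Measurable (extendType s) := by
  refine measurable_pi_lambda _ fun t => ?_
  unfold extendType
  split_ifs <;> fun_prop

/-- The colouring of the other vertices relative to the colour of `s`. -/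
def relType (s : S) (z : S → Bool) (t : {t // t ≠ s}) : Bool := (z t).xor (z s)

lemma measurable_relType (s : S) : Measurable (relType s) := by
  have h : Measurable fun p : Bool × Bool => p.1.xor p.2 := measurable_of_countable _
  refine measurable_pi_lambda _ fun t => ?_
  have ht : Measurable fun z : S → Bool => (z t, z s) := by fun_prop
  exact h.comp ht

lemma typeGraph_congr {z w : S → Bool} (h : ∀ a b, z a ≠ z b ↔ w a ≠ w b) :
    typeGraph z = typeGraph w := by
  funext e
  simp only [typeGraph, h]

lemma typeGraph_extendType_relType (s : S) (z : S → Bool) :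
    typeGraph (extendType s (relType s z)) = typeGraph z := by
  have h (t : S) : extendType s (relType s z) t = (z t).xor (z s) := by
    unfold extendType relType
    split_ifs with h
    · rfl
    · rw [not_not.1 h, Bool.xor_self]
  exact typeGraph_congr fun a b => by simp [h]

lemma relabel_typeGraph (g : Equiv.Perm S) (z : S → Bool) :
    relabel g (typeGraph z) = typeGraph fun t => z (g t) := by
  funext e
  have : (moveEdge g e).1 = e.1.map g.toEmbedding := rfl
  have h : (∃ s ∈ (moveEdge g e).1, ∃ t ∈ (moveEdge g e).1, z s ≠ z t)
      ↔ ∃ s ∈ e.1, ∃ t ∈ e.1, z (g s) ≠ z (g t) := by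
    simp only [this, Finset.mem_map, Equiv.coe_toEmbedding, exists_exists_and_eq_and]
  simp only [relabel, typeGraph, h]

lemma relabel_ofSubtype_extendType [DecidableEq S] (s : S) (g : Equiv.Perm {t // t ≠ s})
    (y : {t // t ≠ s} → Bool) :
    relabel (Equiv.Perm.ofSubtype g) (typeGraph (extendType s y))
      = typeGraph (extendType s fun t => y (g t)) := by
  rw [relabel_typeGraph]
  congr 1
  funext t
  unfold extendType
  by_cases h : t ≠ s
  · have h1 := Equiv.Perm.ofSubtype_apply_of_mem g h
    rw [dif_pos h, dif_pos (by rw [h1]; exact (g ⟨t, h⟩).2)]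
    simp [h1]
  · rw [dif_neg h, dif_neg (by rwa [Equiv.Perm.ofSubtype_apply_of_not_mem g h])]

lemma ofSubtype_mem_finSym [DecidableEq S] {s : S} {g : Equiv.Perm {t // t ≠ s}}
    (hg : g ∈ finSym {t // t ≠ s}) : Equiv.Perm.ofSubtype g ∈ finSym S := by
  refine (Set.Finite.image Subtype.val (show {x | g x ≠ x}.Finite from hg)).subset fun t ht => ?_
  have ht : Equiv.Perm.ofSubtype g t ≠ t := ht
  by_cases h : t ≠ s
  · refine ⟨⟨t, h⟩, fun h' => ht ?_, rfl⟩
    rw [Equiv.Perm.ofSubtype_apply_of_mem g h, h']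
  · exact (ht (Equiv.Perm.ofSubtype_apply_of_not_mem g h)).elim

lemma fairType_singleton (b : Bool) : fairType {b} = 2⁻¹ := by
  simp [fairType]

lemma fairType_preimage_xor (b : Bool) (B : Set Bool) :
    fairType ((fun x => x.xor b) ⁻¹' B) = fairType B := by
  have : fairType.map (fun x : Bool => x.xor b) = fairType := by
    refine Measure.ext_of_singleton fun c => ?_
    rw [Measure.map_apply measurable_from_top (measurableSet_singleton c),
      show (fun x : Bool => x.xor b) ⁻¹' {c} = {c.xor b} by
        ext x; cases x <;> cases b <;> cases c <;> simp,
      fairType_singleton, fairType_singleton]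
  rw [← Measure.map_apply measurable_from_top B.toFinite.measurableSet, this]

/-- Given the colour of `s`, the relative colours are the original ones, possibly all flipped, and a
fair colour is invariant under flipping. -/
lemma map_relType (s : S) :
    (Measure.infinitePi fun _ : S => fairType).map (relType s)
      = Measure.infinitePi fun _ : {t // t ≠ s} => fairType := by
  classical
  refine Measure.eq_infinitePi _ fun F B hB => ?_
  let R (b : Bool) (t : S) : Set Bool :=
    if h : t ≠ s then (fun x => x.xor b) ⁻¹' B ⟨t, h⟩ else {b}
  let F' : Finset S := F.map (Function.Embedding.subtype _)
  let box (b : Bool) : Set (S → Bool) := Set.pi (insert s F' : Finset S) (R b)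
  have hs : s ∉ F' := by simp [F']
  have hR (b : Bool) (t : S) : MeasurableSet (R b t) := (R b t).toFinite.measurableSet
  have hbox (b : Bool) : (Measure.infinitePi fun _ : S => fairType) (box b)
      = 2⁻¹ * ∏ t ∈ F, fairType (B t) := by
    rw [Measure.infinitePi_pi _ fun t _ => hR b t, Finset.prod_insert hs]
    simp only [F', Finset.prod_map]
    congr 1
    · simp [R, fairType_singleton]
    · refine Finset.prod_congr rfl fun t _ => ?_
      simp only [R, Function.Embedding.subtype_apply]
      rw [dif_pos t.2, fairType_preimage_xor]
  have hmem (b : Bool) (z : S → Bool) : z ∈ box b ↔ z s = b ∧ ∀ t ∈ F, (z t).xor b ∈ B t := by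
    simp only [box, Set.mem_pi, Finset.mem_coe, Finset.mem_insert, forall_eq_or_imp, F',
      Finset.mem_map, Function.Embedding.subtype_apply]
    refine and_congr (by simp [R]) ⟨fun h t ht => ?_, ?_⟩
    · have := h t ⟨t, ht, rfl⟩
      simp only [R, dif_pos t.2] at this
      exact this
    · rintro h _ ⟨t, ht, rfl⟩
      simp only [R, dif_pos t.2]
      exact h t ht
  -- Split by the colour of `s`; each half carries weight 1/2 times the same product.
  have hpre : relType s ⁻¹' (Set.pi (F : Set {t // t ≠ s}) B) = box true ∪ box false := by
    ext z
    simp only [Set.mem_preimage, Set.mem_union, hmem, Set.mem_pi, Finset.mem_coe, relType]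
    cases z s <;> simp
  have hdisj : Disjoint (box true) (box false) := by
    rw [Set.disjoint_left]
    intro z h1 h2
    have h1 := ((hmem _ _).1 h1).1
    have h2 := ((hmem _ _).1 h2).1
    simp [h1] at h2
  have hbm : MeasurableSet (box false) :=
    MeasurableSet.pi (Finset.countable_toSet _) fun t _ => hR _ t
  rw [Measure.map_apply (measurable_relType s)
    (MeasurableSet.pi (Finset.countable_toSet _) fun t _ => hB t), hpre,
    measure_union hdisj hbm, hbox, hbox, ← add_mul, ENNReal.inv_two_add_inv_two, one_mul]

/-- The colour of one vertex may be fixed without changing the law of the graph. -/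
lemma measurePreserving_typeGraph_extendType (s : S) :
    MeasurePreserving (fun y => typeGraph (extendType s y))
      (Measure.infinitePi fun _ : {t // t ≠ s} => fairType) (bipartiteLaw S) where
  measurable := measurable_typeGraph.comp (measurable_extendType s)
  map_eq := by
    rw [← map_relType s, Measure.map_map (g := fun y => typeGraph (extendType s y)) (measurable_typeGraph.comp (measurable_extendType s))
      (measurable_relType s), bipartiteLaw]
    congr 1
    funext z
    exact typeGraph_extendType_relType s z

end Normalization

/-! ### Symmetry, triviality and edge probabilities of the bipartite law. -/

section Law

variable {S : Type*}

lemma measurable_relabel (g : Equiv.Perm S) : Measurable (relabel g) :=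
  measurable_pi_lambda _ fun e => measurable_pi_apply (moveEdge g e)

lemma exchangeable_bipartiteLaw : Exchangeable (bipartiteLaw S) := by
  intro g _
  have hg := measurePreserving_comp_perm fairType g
  rw [bipartiteLaw, Measure.map_map (measurable_relabel g) measurable_typeGraph,
    show relabel g ∘ typeGraph = typeGraph ∘ fun (z : S → Bool) t => z (g t) from
      funext fun z => relabel_typeGraph g z,
    ← Measure.map_map measurable_typeGraph hg.measurable, hg.map_eq]

/-- Events that are almost invariant under the stabilizer of a vertex are trivial. -/
theorem bipartiteLaw_eq_zero_or_one [Infinite S] (s : S) {A : Set (Graph S)}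
    (hA : MeasurableSet A)
    (hinv : ∀ g ∈ finSym S, g s = s → relabel g ⁻¹' A =ᵐ[bipartiteLaw S] A) :
    bipartiteLaw S A = 0 ∨ bipartiteLaw S A = 1 := by
  classical
  have hp := measurePreserving_typeGraph_extendType s
  have : Infinite {t // t ≠ s} := (Set.finite_singleton s).infinite_compl.to_subtype
  rw [← hp.measure_preimage hA.nullMeasurableSet]
  refine measure_eq_zero_or_one_of_ae_symmetric fairType (hp.measurable hA) fun g hg => ?_
  have h := hp.quasiMeasurePreserving.preimage_ae_eq (hinv _ (ofSubtype_mem_finSym hg)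
    (Equiv.Perm.ofSubtype_apply_of_not_mem g (by simp)))
  rw [← Set.preimage_comp] at h
  rw [← Set.preimage_comp]
  have hcomp : relabel (Equiv.Perm.ofSubtype g) ∘ (fun y => typeGraph (extendType s y))
      = (fun y => typeGraph (extendType s y)) ∘ fun y t => y (g t) :=
    funext fun y => relabel_ofSubtype_extendType s g y
  rwa [hcomp] at h

lemma bipartiteLaw_stabInvariants [Infinite S] (s : S) {A : Set (Graph S)}
    (hA : MeasurableSet[stabInvariants s] A) : bipartiteLaw S A = 0 ∨ bipartiteLaw S A = 1 := by
  rw [stabInvariants, MeasurableSpace.measurableSet_iInf] at hA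
  -- The identity permutation is used only to extract measurability of the event.
  refine bipartiteLaw_eq_zero_or_one s (hA ⟨1, one_mem _, rfl⟩).1 fun g hg hgs => ?_
  exact Filter.EventuallyEq.of_eq (hA ⟨g, hg, hgs⟩).2

lemma bipartiteLaw_proj_ne_zero (e : Edge S) : bipartiteLaw S (proj e ⁻¹' {1}) ≠ 0 := by
  classical
  obtain ⟨a, b, hab, he⟩ := Finset.card_eq_two.1 e.2
  let R (t : S) : Set Bool := if t = a then {true} else {false}
  have hsub : Set.pi (({a, b} : Finset S) : Set S) R ⊆ typeGraph ⁻¹' (proj e ⁻¹' {1}) := by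
    intro z hz
    have ha : z a = true := by simpa [R] using hz a (by simp)
    have hb : z b = false := by simpa [R, hab.symm] using hz b (by simp)
    have : ∃ s ∈ e.1, ∃ t ∈ e.1, z s ≠ z t :=
      ⟨a, by simp [he], b, by simp [he], by simp [ha, hb]⟩
    simp only [Set.mem_preimage, proj, typeGraph, if_pos this, Set.mem_singleton_iff]
  have hm : MeasurableSet (proj e ⁻¹' {(1 : Fin 2)}) :=
    measurable_pi_apply e (measurableSet_singleton _)
  rw [bipartiteLaw, Measure.map_apply measurable_typeGraph hm]
  refine ne_of_gt (lt_of_lt_of_le ?_ (measure_mono hsub))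
  rw [Measure.infinitePi_pi _ fun t _ => (R t).toFinite.measurableSet, Finset.prod_pair hab]
  simp [R, hab.symm, fairType_singleton]

/-- A bipartite graph has no triangles. -/
lemma bipartiteLaw_triangle [DecidableEq S] {e₁ e₂ e₃ : Edge S} {a b c : S}
    (h₁ : e₁.1 = {a, b}) (h₂ : e₂.1 = {b, c}) (h₃ : e₃.1 = {a, c}) :
    bipartiteLaw S (⋂ e ∈ ({e₁, e₂, e₃} : Set (Edge S)), proj e ⁻¹' {1}) = 0 := by
  classical
  have hm : MeasurableSet (⋂ e ∈ ({e₁, e₂, e₃} : Set (Edge S)), proj e ⁻¹' {(1 : Fin 2)}) :=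
    MeasurableSet.biInter (Set.toFinite _).countable fun e _ =>
      measurable_pi_apply e (measurableSet_singleton _)
  rw [bipartiteLaw, Measure.map_apply measurable_typeGraph hm]
  rw [← measure_empty (μ := Measure.infinitePi fun _ : S => fairType)]
  congr 1
  rw [Set.eq_empty_iff_forall_notMem]
  intro z hz
  simp only [Set.mem_preimage, Set.mem_iInter, Set.mem_insert_iff, Set.mem_singleton_iff,
    forall_eq_or_imp, forall_eq, proj, typeGraph, h₁, h₂, h₃] at hz
  obtain ⟨hz₁, hz₂, hz₃⟩ := hz
  simp only [Finset.mem_insert, Finset.mem_singleton, exists_eq_or_imp, exists_eq_left,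
    ite_eq_left_iff] at hz₁ hz₂ hz₃
  revert hz₁ hz₂ hz₃
  cases z a <;> cases z b <;> cases z c <;> simp

end Law

/-! ### No covariant family makes the edges relatively independent. -/

section Triviality

/-- A trivial σ-algebra is independent of every event, so conditioning on it changes nothing. -/
lemma condExp_of_trivial {Ω : Type*} {m m₀ : MeasurableSpace Ω} (hm : m ≤ m₀) (μ : Measure Ω)
    [IsProbabilityMeasure μ] (htriv : ∀ A, MeasurableSet[m] A → μ A = 0 ∨ μ A = 1)
    {B : Set Ω} (hB : MeasurableSet B) :
    μ⟦B | m⟧ =ᵐ[μ] fun _ => μ.real B := by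
  have hind : Indep m₀ m μ := by
    rw [Indep_iff]
    intro C A _ hA
    rcases htriv A hA with h | h
    · rw [h, mul_zero]
      exact measure_mono_null Set.inter_subset_right h
    · rw [h, mul_one, Set.inter_comm]
      exact Measure.measure_inter_eq_of_ae
        ((prob_compl_eq_zero_iff (hm A hA)).2 h)
  have := condExp_indep_eq le_rfl hm
    ((stronglyMeasurable_const (b := (1 : ℝ))).indicator hB) hind
  rwa [integral_indicator_const _ hB, smul_eq_mul, mul_one] at this

lemma combined_trivial {S Z : Type*} [Infinite S] [MeasurableSpace Z]
    {φ : S → Graph S → Z} (hφ : ∀ s, Measurable (φ s)) (hcov : Covariant (bipartiteLaw S) φ)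
    {A : Set (Graph S)} (hA : MeasurableSet[MeasurableSpace.comap (combined φ) inferInstance] A) :
    bipartiteLaw S A = 0 ∨ bipartiteLaw S A = 1 := by
  obtain ⟨B, hB, rfl⟩ := hA
  -- Sets almost equal to `∅` or the whole space form a σ-algebra, so it suffices to check each
  -- coordinate `φ s` separately.
  have hmeas : @Measurable _ _ (eventuallyMeasurableSpace ⊥ (ae (bipartiteLaw S))) _
      (combined φ) := by
    refine @measurable_pi_lambda _ _ _ (_) _ _ fun s B hB => ?_
    have h01 := bipartiteLaw_eq_zero_or_one s (hφ s hB) fun g hg hgs => by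
      have := (hcov g hg s).preimage B
      rwa [hgs] at this
    rcases h01 with h | h
    · exact ⟨∅, MeasurableSpace.measurableSet_empty _, ae_eq_empty.2 h⟩
    · refine ⟨Set.univ, @MeasurableSet.univ _ (_), ?_⟩
      exact ae_eq_univ.2 ((prob_compl_eq_zero_iff (hφ s hB)).2 h)
  obtain ⟨C, hC, hBC⟩ := hmeas hB
  rw [measure_congr hBC]
  rcases MeasurableSpace.measurableSet_bot_iff.1 hC with rfl | rfl
  · exact Or.inl measure_empty
  · exact Or.inr measure_univ

lemma not_edgesRelIndep {S Z : Type*} [Countable S] [Infinite S] [MeasurableSpace Z]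
    {φ : S → Graph S → Z} (hφ : ∀ s, Measurable (φ s)) (hcov : Covariant (bipartiteLaw S) φ) :
    ¬ EdgesRelIndep (bipartiteLaw S) φ hφ := by
  classical
  intro hind
  obtain ⟨t, ht⟩ := Infinite.exists_subset_card_eq S 3
  obtain ⟨a, b, c, hab, hac, hbc, rfl⟩ := Finset.card_eq_three.1 ht
  let e₁ : Edge S := ⟨{a, b}, Finset.card_pair hab⟩
  let e₂ : Edge S := ⟨{b, c}, Finset.card_pair hbc⟩
  let e₃ : Edge S := ⟨{a, c}, Finset.card_pair hac⟩
  have hm (e : Edge S) : MeasurableSet (proj e ⁻¹' {(1 : Fin 2)}) :=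
    measurable_pi_apply e (measurableSet_singleton _)
  have h := (iCondIndepFun_iff_condExp_inter_preimage_eq_mul (fun _ => inferInstance)
    (fun e : Edge S => proj e) fun e => measurable_pi_apply e).1 hind {e₁, e₂, e₃}
    (sets := fun _ => {1}) fun _ _ => measurableSet_singleton _
  have hc {B : Set (Graph S)} (hB : MeasurableSet B) :=
    condExp_of_trivial (measurable_combined hφ).comap_le (bipartiteLaw S)
      (fun A hA => combined_trivial hφ hcov hA) hB
  have h0 := hc (MeasurableSet.biInter (Finset.countable_toSet {e₁, e₂, e₃}) fun e _ => hm e)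
  have hall := (ae_ball_iff (Finset.countable_toSet {e₁, e₂, e₃})).2 fun e _ => hc (hm e)
  -- At one point where all these almost sure identities hold, the conditional product formula
  -- becomes an identity between plain probabilities.
  obtain ⟨ω, h1, h2, h3⟩ := (h.and (h0.and hall)).exists
  rw [Finset.prod_apply] at h1
  replace h1 := h2.symm.trans (h1.trans (Finset.prod_congr rfl h3))
  have hz := bipartiteLaw_triangle (e₁ := e₁) (e₂ := e₂) (e₃ := e₃) (a := a) (b := b) (c := c)
    rfl rfl rfl
  have hz' : (bipartiteLaw S).real
      (⋂ e ∈ ({e₁, e₂, e₃} : Finset (Edge S)), proj e ⁻¹' {(1 : Fin 2)}) = 0 := by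
    rw [measureReal_def, ← ENNReal.toReal_zero, ← hz]
    simp
  replace h1 := hz'.symm.trans h1
  obtain ⟨e, _, he⟩ := Finset.prod_eq_zero_iff.1 h1.symm
  exact bipartiteLaw_proj_ne_zero e ((measureReal_eq_zero_iff (measure_ne_top _ _)).1 he)

end Triviality

end ExchGraph

theorem mainTheorem11 {S : Type*} [Countable S] [Infinite S] :
    ExchGraph.Exchangeable (ExchGraph.bipartiteLaw S) ∧
    (∀ (s : S) (A : Set (ExchGraph.Graph S)),
      MeasurableSet[ExchGraph.stabInvariants s] A →
        ExchGraph.bipartiteLaw S A = 0 ∨ ExchGraph.bipartiteLaw S A = 1) ∧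
    (∀ (Z : Type*) [MeasurableSpace Z] [StandardBorelSpace Z],
      ¬ ∃ (φ : S → ExchGraph.Graph S → Z) (hφ : ∀ s, Measurable (φ s)),
        ExchGraph.Covariant (ExchGraph.bipartiteLaw S) φ ∧
        ExchGraph.EdgesRelIndep (ExchGraph.bipartiteLaw S) φ hφ) :=
  ⟨ExchGraph.exchangeable_bipartiteLaw,
    fun s _ hA => ExchGraph.bipartiteLaw_stabInvariants s hA,
    fun _ _ _ ⟨_, hφ, hcov, hind⟩ => ExchGraph.not_edgesRelIndep hφ hcov hind⟩
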